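/- Let $\mathbb K\in\{\mathbb R,\mathbb C\}$. A linear map $T:A\to B$ of unital $*$-algebras over $\mathbb K$ is completely positive if for every $n$ the map $[a_{ij}]\mapsto[T(a_{ij})]$, $\mathrm{Mat}_n(A)\to\mathrm{Mat}_n(B)$, maps positive elements (finite sums of elements $b^*b$) to positive elements. Let $M$ be a non-empty compact Hausdorff space and let $(\mathcal A_M,H_M,D_M)$ be a spectral triple over $M$: $\mathcal A_M$ is a dense unital $*$-subalgebra of $A_M:=C(M,\mathbb K)$, $A_M$ is faithfully and unitally $*$-represented on the Hilbert space $H_M$, $D_M$ is a self-adjoint (possibly unbounded) operator on $H_M$, and $[D_M,a]$ is bounded for all $a\in\mathcal A_M$ (for example the canonical spectral triple $(C^\infty(M),L^2(M,S),D_M)$ of a compact Riemannian spin manifold). Let $(A_F,H_F,D_F)$ be a finite spectral triple: $H_F\neq0$ is a finite-dimensional Hilbert space, $A_F$ is a unital $*$-algebra faithfully and unitally $*$-represented on $H_F$, and $D_F$ is a symmetric operator on $H_F$. On $H_F\otimes H_M$ put $$D^2=1\otimes D_M^2+D_F^2\otimes1,\qquad \operatorname{dom}(D^2)=H_F\otimes\operatorname{dom}(D_M^2),$$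 and let $e^{-tD_M^2}$, $e^{-tD_F^2}$, $e^{-tD^2}$ $(t\ge0)$ be the strongly continuous semigroups on $H_M$, $H_F$, $H_F\otimes H_M$ with generators $-D_M^2$, $-D_F^2$, $-D^2$. The heat operators act on the algebras in the following sense. Realise $A_M$ and $A_F$ in their Hilbert spaces by families of linear maps $\iota^M_j:A_M\to H_M$ $(j\in J)$ and $\iota^F_i:A_F\to H_F$ $(i\in I)$, each family separating the elements of the algebra (for example a single injective linear map, or the maps $a\mapsto a\xi$, $\xi\in H$), and realise $A_F\otimes A_M\cong C(M,A_F)$ in $H_F\otimes H_M$ by the family $\iota^F_i\otimes\iota^M_j$. For an algebra $A$ realised in $H$ by $(\iota_k)$, a semigroup $(U_t)_{t\ge0}$ on $H$ is called completely positive on $A$ if for every $t\ge0$ there is a (necessarily unique) linear map $T_t:A\to A$ with $\iota_k(T_ta)=U_t\,\iota_k(a)$ for all $k$ and $a$, and $T_t$ is completely positive; it is called conservative if $U_t\,\iota_k(1)=\iota_k(1)$ for all $k$ and $t\ge0$, i.e. $T_t(1)=1$. **Theorem.** If $e^{-tD_M^2}$ is completely positive on $A_M$ and $e^{-tD_F^2}$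 is completely positive on $A_F$, then $e^{-tD^2}$ is completely positive on $A_F\otimes A_M$. Conversely, if $e^{-tD^2}$ is conservative and completely positive on $A_F\otimes A_M$, then $e^{-tD_M^2}$ is completely positive on $A_M$ and $e^{-tD_F^2}$ is completely positive on $A_F$. -/

import Mathlib

open scoped TensorProduct Topology

/-- The positive cone of a `*`-algebra: finite sums of elements `b⋆ b`. (In a C⋆-algebra these
are exactly the positive elements.) -/
def IsPosElem {A : Type*} [Ring A] [StarRing A] (x : A) : Prop :=
  x ∈ AddSubmonoid.closure (Set.range fun b : A => star b * b)

/-- A linear map `T : A → B` of unital `*`-algebras is completely positive if for every `n` the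
entrywise map `Mat_n(A) → Mat_n(B)`, `[a_ij] ↦ [T a_ij]`, sends positive elements to positive
elements; the involution of `Mat_n(A)` is the conjugate transpose. -/
def IsCompletelyPositive {𝕜 A B : Type*} [RCLike 𝕜]
    [Ring A] [StarRing A] [Algebra 𝕜 A] [Ring B] [StarRing B] [Algebra 𝕜 B]
    (T : A →ₗ[𝕜] B) : Prop :=
  ∀ (n : ℕ) (x : Matrix (Fin n) (Fin n) A), IsPosElem x → IsPosElem (x.map T)

/-- A spectral triple `(𝒜, H, D)`, `𝒜` being a dense unital `*`-subalgebra `smooth` of the (closed)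
`*`-algebra `A`: a faithful unital `*`-representation of `A` on the Hilbert space `H` and a
self-adjoint, possibly unbounded, operator `D` on `H` such that `[D, a]` is bounded
for all `a ∈ 𝒜`. -/
structure SpectralTriple (𝕜 A H : Type*) [RCLike 𝕜]
    [Ring A] [StarRing A] [Algebra 𝕜 A] [StarModule 𝕜 A] [TopologicalSpace A]
    [NormedAddCommGroup H] [InnerProductSpace 𝕜 H] [CompleteSpace H] where
  smooth : StarSubalgebra 𝕜 A
  dense_smooth : Dense (smooth : Set A)
  rep : A →⋆ₐ[𝕜] (H →L[𝕜] H)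
  rep_injective : Function.Injective rep
  D : H →ₗ.[𝕜] H
  dense_domain : Dense (D.domain : Set H)
  selfAdjoint : IsSelfAdjoint D
  bounded_commutator : ∀ a ∈ smooth, ∃ B : H →L[𝕜] H, ∀ (x : H) (hx : x ∈ D.domain),
    ∃ hax : rep a x ∈ D.domain, D ⟨rep a x, hax⟩ - rep a (D ⟨x, hx⟩) = B x

/-- A finite spectral triple `(A, H, D)`: `H` is a finite dimensional Hilbert space, `A` is
faithfully represented on it, and `D` is a symmetric operator. -/
structure FiniteSpectralTriple (𝕜 A H : Type*) [RCLike 𝕜]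
    [Ring A] [StarRing A] [Algebra 𝕜 A] [StarModule 𝕜 A]
    [NormedAddCommGroup H] [InnerProductSpace 𝕜 H] [CompleteSpace H] [FiniteDimensional 𝕜 H] where
  rep : A →⋆ₐ[𝕜] (H →L[𝕜] H)
  rep_injective : Function.Injective rep
  D : H →L[𝕜] H
  selfAdjoint : IsSelfAdjoint D

/-- The square of an unbounded operator, with domain `{x ∈ dom D | D x ∈ dom D}`. -/
noncomputable def LinearPMap.square {𝕜 H : Type*} [RCLike 𝕜]
    [NormedAddCommGroup H] [InnerProductSpace 𝕜 H] (D : H →ₗ.[𝕜] H) : H →ₗ.[𝕜] H :=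
  D.comp (D.domRestrict ((D.domain.comap D.toFun).map D.domain.subtype)) (by
    rintro ⟨x, hx, hx'⟩
    obtain ⟨⟨y, hy⟩, hy', rfl⟩ := hx
    exact hy')

/-- `U` is the strongly continuous one-parameter semigroup `U t = e^{-tL}`, `t ≥ 0`, of bounded
operators on `E` whose generator is exactly `-L`, the operator `L` being given by its graph. -/
structure IsExpNeg {𝕜 E : Type*} [RCLike 𝕜] [NormedAddCommGroup E] [NormedSpace 𝕜 E]
    (L : Submodule 𝕜 (E × E)) (U : ℝ → E →L[𝕜] E) : Prop where
  zero : U 0 = 1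
  add : ∀ s t : ℝ, 0 ≤ s → 0 ≤ t → U (s + t) = U s * U t
  continuousOn : ∀ x : E, ContinuousOn (fun t : ℝ => U t x) (Set.Ici 0)
  generator : ∀ x y : E, (x, y) ∈ L ↔
    Filter.Tendsto (fun t : ℝ => ((t⁻¹ : ℝ) : 𝕜) • (x - U t x)) (𝓝[>] 0) (𝓝 y)

/-- The graph of the operator `D² = 1 ⊗ D_M² + D_F² ⊗ 1` on `H_F ⊗ H_M`, with domain
`H_F ⊗ dom(D_M²)`. Since `H_F` is finite dimensional, the algebraic tensor product `H_F ⊗ H_M`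
is complete and `D²` is self-adjoint on this domain. -/
noncomputable def productDiracSq {𝕜 HF HM : Type*} [RCLike 𝕜]
    [NormedAddCommGroup HF] [InnerProductSpace 𝕜 HF]
    [NormedAddCommGroup HM] [InnerProductSpace 𝕜 HM]
    (DF : HF →L[𝕜] HF) (DM : HM →ₗ.[𝕜] HM) :
    Submodule 𝕜 ((HF ⊗[𝕜] HM) × (HF ⊗[𝕜] HM)) :=
  LinearMap.range (LinearMap.prod
    (TensorProduct.map LinearMap.id DM.square.domain.subtype)
    (TensorProduct.map LinearMap.id DM.square.toFun +
      TensorProduct.map (DF ∘L DF).toLinearMap DM.square.domain.subtype))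

/-- The heat operators `e^{-tD_F²}` of a finite spectral triple. -/
noncomputable def finiteHeat {𝕜 HF : Type*} [RCLike 𝕜]
    [NormedAddCommGroup HF] [InnerProductSpace 𝕜 HF]
    (DF : HF →L[𝕜] HF) (t : ℝ) : HF →L[𝕜] HF :=
  NormedSpace.exp (-((t : 𝕜) • (DF ∘L DF)))

/-- A family of linear maps `ι i : A → H` realises the algebra `A` in the Hilbert space `H` when it
separates the elements of `A`. Examples: one injective map `A → H` (such as the inclusion of `A` in
`L²(A, τ)`), or the family `a ↦ a ξ`, `ξ ∈ H`, for an algebra of operators. -/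
def IsRealization {𝕜 A H I : Type*} [RCLike 𝕜]
    [Ring A] [Algebra 𝕜 A] [NormedAddCommGroup H] [NormedSpace 𝕜 H]
    (ι : I → A →ₗ[𝕜] H) : Prop :=
  ∀ a : A, (∀ i, ι i a = 0) → a = 0

/-- The realisation `(a ⊗ b) ↦ ι_i(a) ⊗ κ_j(b)` of a tensor product algebra. -/
noncomputable def productRealization {𝕜 A B H K I J : Type*} [RCLike 𝕜]
    [Ring A] [Algebra 𝕜 A] [Ring B] [Algebra 𝕜 B]
    [NormedAddCommGroup H] [InnerProductSpace 𝕜 H] [NormedAddCommGroup K] [InnerProductSpace 𝕜 K]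
    (ι : I → A →ₗ[𝕜] H) (κ : J → B →ₗ[𝕜] K) : I × J → (A ⊗[𝕜] B) →ₗ[𝕜] (H ⊗[𝕜] K) :=
  fun p => TensorProduct.map (ι p.1) (κ p.2)

/-- A semigroup `U` of operators on `H` is completely positive on the `*`-algebra `A`, realised in
`H` by `ι`, if each `U t`, `t ≥ 0`, acts on `A` (that is, `U t (ι_i a) = ι_i (T a)` for a linear
map `T : A → A`, which is unique) and this action is completely positive. -/
def IsCompletelyPositiveOn {𝕜 A H I : Type*} [RCLike 𝕜]
    [Ring A] [StarRing A] [Algebra 𝕜 A] [NormedAddCommGroup H] [NormedSpace 𝕜 H]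
    (ι : I → A →ₗ[𝕜] H) (U : ℝ → H →L[𝕜] H) : Prop :=
  ∀ t : ℝ, 0 ≤ t → ∃ T : A →ₗ[𝕜] A, (∀ i a, ι i (T a) = U t (ι i a)) ∧ IsCompletelyPositive T

/-- A semigroup `U` on `H` is conservative on the unital algebra `A`, realised in `H` by `ι`, if
each `U t`, `t ≥ 0`, fixes the unit of `A`. -/
def IsConservativeOn {𝕜 A H I : Type*} [RCLike 𝕜]
    [Ring A] [Algebra 𝕜 A] [NormedAddCommGroup H] [NormedSpace 𝕜 H]
    (ι : I → A →ₗ[𝕜] H) (U : ℝ → H →L[𝕜] H) : Prop :=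
  ∀ t : ℝ, 0 ≤ t → ∀ i, U t (ι i 1) = ι i 1

/-! The tensor products `e^{-tD_F²} ⊗ e^{-tD_M²}` form a strongly continuous semigroup whose
generator extends `-D²`. Differentiating `V (t - s) (U s x)` in `s` shows that it agrees with
`e^{-tD²}` on the domain of `D²`, and density gives equality (`product_heat_eq_mapL`). Both
directions thus concern a product `E ⊗ F` of operators.

Direct part: `S ⊗ T` must be completely positive when `S` and `T` are, with squares taken inside
`A_F ⊗ C(M)`. A faithful representation of `A_F` by matrices embeds `Mat_n(A_F ⊗ C(M))` as a closed
`*`-subalgebra of `C(M, Mat_{nN}(𝕜))`. A pointwise positive semidefinite element has a square root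
there, obtained as a norm limit of polynomials, so positivity is a pointwise condition
(`isPosElem_of_posSemidef_flatten`). Now `id ⊗ T` is `T` applied to the entries, and `S ⊗ id` acts
as `S` at each point of `M`.

Converse: conservativity makes the two realised units eigenvectors of `E` and `F` with inverse
eigenvalues, positive because heat operators are squares of self-adjoint ones. Hence the product map
sends `a ⊗ 1` to a positive multiple of `E a ⊗ 1`, and slicing by a point evaluation on `C(M)`
recovers `E`; a vector state of `A_F` recovers `F` in the same way. -/

/-! ### Uniqueness of semigroups and density of generators -/

section Semigroup

open Filter Set

variable {𝕜 E : Type*} [RCLike 𝕜] [NormedAddCommGroup E] [NormedSpace 𝕜 E]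

/-- Two semigroups with comparable generators agree on the domain of the generator: `U` has
generator `-L`, and the generator of `V` extends `-L`. -/
theorem IsExpNeg.apply_eq_of_tendsto {L : Submodule 𝕜 (E × E)} {U V : ℝ → E →L[𝕜] E}
    (hU : IsExpNeg L U) (V0 : V 0 = 1)
    (Vadd : ∀ s t : ℝ, 0 ≤ s → 0 ≤ t → V (s + t) = V s * V t)
    (Vcont : ∀ x : E, ContinuousOn (fun t : ℝ => V t x) (Ici 0))
    (Vbdd : ∀ t : ℝ, ∃ C, ∀ s ∈ Icc 0 t, ‖V s‖ ≤ C)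
    (Vgen : ∀ x y : E, (x, y) ∈ L →
      Tendsto (fun t : ℝ => ((t⁻¹ : ℝ) : 𝕜) • (x - V t x)) (𝓝[>] 0) (𝓝 y))
    {t : ℝ} (ht : 0 ≤ t) {x y : E} (hxy : (x, y) ∈ L) : U t x = V t x := by
  let _ : NormedSpace ℝ E := NormedSpace.restrictScalars ℝ 𝕜 E
  have hsm : ∀ (r : ℝ) (z : E), r • z = (r : 𝕜) • z := fun r z => rfl
  obtain ⟨C, hC⟩ := Vbdd t
  have hUgen := (hU.generator x y).1 hxy
  -- The domain is invariant: `U s` commutes with the difference quotients of `U` at zero.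
  have hUL : ∀ s, 0 ≤ s → (U s x, U s y) ∈ L := by
    intro s hs
    refine (hU.generator _ _).2 ?_
    refine (((U s).continuous.tendsto y).comp hUgen).congr' ?_
    filter_upwards [self_mem_nhdsWithin] with h hh
    have h1 : U s (U h x) = U h (U s x) := by
      rw [← mul_apply_eq_comp, ← mul_apply_eq_comp,
        ← hU.add s h hs (le_of_lt hh), ← hU.add h s (le_of_lt hh) hs, add_comm]
    simp [h1]
  -- This path joins `V t x` to `U t x`. For continuity, apply `V (t - r)` to `(U r x - U s x) + U s
  -- x` and use the uniform bound on `V`.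
  have hcont : ContinuousOn (fun s => V (t - s) (U s x)) (Icc 0 t) := by
    intro s hs
    have hA : Tendsto (fun r => V (t - r) (U r x - U s x)) (𝓝[Icc 0 t] s) (𝓝 0) := by
      have h1 : Tendsto (fun r => U r x - U s x) (𝓝[Icc 0 t] s) (𝓝 0) := by
        have := ((hU.continuousOn x).mono Icc_subset_Ici_self) s hs
        simpa using this.tendsto.sub_const (U s x)
      refine squeeze_zero_norm' (a := fun r => C * ‖U r x - U s x‖) ?_
        (by simpa using h1.norm.const_mul C)
      filter_upwards [self_mem_nhdsWithin] with r hr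
      exact (V (t - r)).le_of_opNorm_le (hC _ ⟨by linarith [hr.2], by linarith [hr.1]⟩) _
    have hB : Tendsto (fun r => V (t - r) (U s x)) (𝓝[Icc 0 t] s) (𝓝 (V (t - s) (U s x))) := by
      have h2 : ContinuousOn (fun r => V (t - r) (U s x)) (Icc 0 t) :=
        (Vcont (U s x)).comp (by fun_prop) (fun r hr => by simpa using hr.2)
      exact h2 s hs
    have := hA.add hB
    simp only [map_sub, sub_add_cancel, zero_add] at this
    exact this
  -- With `h = r - s`, the increment is `V (t - r)` applied to `(U s x - V h (U s x)) - U s (x - U h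
  -- x)`. Divided by `h`, both brackets tend to `U s y`.
  have hderiv : ∀ s ∈ Ico 0 t, HasDerivWithinAt (fun s => V (t - s) (U s x)) 0 (Ici s) s := by
    intro s hs
    rw [← hasDerivWithinAt_Ioi_iff_Ici, hasDerivWithinAt_iff_tendsto_slope' (by simp)]
    have hshift : Tendsto (fun r : ℝ => r - s) (𝓝[>] s) (𝓝[>] 0) := by
      refine tendsto_nhdsWithin_iff.2 ⟨?_, ?_⟩
      · have : Tendsto (fun r : ℝ => r - s) (𝓝 s) (𝓝 (s - s)) := by
          exact (continuous_id.sub continuous_const).tendsto s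
        rw [sub_self] at this
        exact this.mono_left nhdsWithin_le_nhds
      · filter_upwards [self_mem_nhdsWithin] with r hr
        simpa using hr
    have h1 := (((U s).continuous.tendsto y).comp hUgen).comp hshift
    have h2 := (Vgen _ _ (hUL s hs.1)).comp hshift
    have h3 := h2.sub h1
    rw [sub_self] at h3
    have h4 := h3.norm.const_mul C
    rw [norm_zero, mul_zero] at h4
    refine squeeze_zero_norm' ?_ h4
    filter_upwards [Ioo_mem_nhdsGT hs.2] with r hr
    have hr0 : 0 ≤ r - s := by linarith [hr.1]
    have e1 : U r x = U s (U (r - s) x) := by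
      rw [← mul_apply_eq_comp, ← hU.add s (r - s) hs.1 hr0, add_sub_cancel]
    have e2 : V (t - s) (U s x) = V (t - r) (V (r - s) (U s x)) := by
      rw [← mul_apply_eq_comp (V (t - r)), ← Vadd (t - r) (r - s) (by linarith [hr.2]) hr0]
      congr 2; ring
    rw [slope_def_module, e2, e1, ← map_sub, hsm, ← map_smul]
    refine ((V (t - r)).le_of_opNorm_le
      (hC _ ⟨by linarith [hr.2], by linarith [hr.1, hs.1]⟩) _).trans (le_of_eq ?_)
    congr 2
    simp only [Function.comp, map_smul, map_sub (U s), smul_sub]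
    abel
  have := constant_of_has_deriv_right_zero hcont hderiv t (right_mem_Icc.2 ht)
  simpa [hU.zero, V0] using this

theorem IsExpNeg.exists_norm_le [CompleteSpace E] {L : Submodule 𝕜 (E × E)}
    {U : ℝ → E →L[𝕜] E} (hU : IsExpNeg L U) (t : ℝ) : ∃ C, ∀ s ∈ Icc 0 t, ‖U s‖ ≤ C := by
  obtain ⟨C, hC⟩ := banach_steinhaus (g := fun s : Icc (0 : ℝ) t => U s) (fun x => by
    obtain ⟨C, hC⟩ := isCompact_Icc.exists_bound_of_continuousOn
      ((hU.continuousOn x).mono Icc_subset_Ici_self)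
    exact ⟨C, fun i => hC i i.2⟩)
  exact ⟨C, fun s hs => hC ⟨s, hs⟩⟩

/-- The generator of a strongly continuous semigroup is densely defined. -/
theorem IsExpNeg.dense_domain [CompleteSpace E] {L : Submodule 𝕜 (E × E)}
    {U : ℝ → E →L[𝕜] E} (hU : IsExpNeg L U) : Dense {x : E | ∃ y, (x, y) ∈ L} := by
  let _ : NormedSpace ℝ E := NormedSpace.restrictScalars ℝ 𝕜 E
  have : IsScalarTower ℝ 𝕜 E := RestrictScalars.isScalarTower ℝ 𝕜 E
  have hsm : ∀ (r : ℝ) (z : E), r • z = (r : 𝕜) • z := fun r z => rfl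
  intro x
  have hint : ∀ a b, 0 ≤ a → 0 ≤ b → IntervalIntegrable (fun s => U s x) MeasureTheory.volume a b :=
    fun a b ha hb => ((hU.continuousOn x).mono (fun s hs => by
      rcases le_total a b with h | h
      · rw [uIcc_of_le h] at hs; exact ha.trans hs.1
      · rw [uIcc_of_ge h] at hs; exact hb.trans hs.1)).intervalIntegrable
  have hright : ∀ a, 0 ≤ a →
      Tendsto (fun r : ℝ => r⁻¹ • ∫ s in a..(a + r), U s x) (𝓝[>] 0) (𝓝 (U a x)) := by
    intro a ha
    have hd : HasDerivWithinAt (fun u => ∫ s in a..u, U s x) (U a x) (Ici a) a := by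
      refine intervalIntegral.integral_hasDerivWithinAt_right (by simp) ?_ ?_ (t := Ioi a)
      · exact ((hU.continuousOn x).mono (Ioi_subset_Ici_self.trans
          (Ici_subset_Ici.2 ha))).stronglyMeasurableAtFilter_nhdsWithin measurableSet_Ioi a
      · exact ((hU.continuousOn x) a ha).mono (Ioi_subset_Ici_self.trans (Ici_subset_Ici.2 ha))
    rw [← hasDerivWithinAt_Ioi_iff_Ici, hasDerivWithinAt_iff_tendsto_slope' (by simp)] at hd
    have hshift : Tendsto (fun r : ℝ => a + r) (𝓝[>] 0) (𝓝[>] a) := by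
      refine tendsto_nhdsWithin_iff.2 ⟨?_, ?_⟩
      · have : Tendsto (fun r : ℝ => a + r) (𝓝 0) (𝓝 (a + 0)) :=
          (continuous_const.add continuous_id).tendsto 0
        rw [add_zero] at this
        exact this.mono_left nhdsWithin_le_nhds
      · filter_upwards [self_mem_nhdsWithin] with r hr
        simpa using hr
    refine (hd.comp hshift).congr fun r => ?_
    simp [slope_def_module]
  -- `U r` shifts the window of integration by `r`, so the difference of the integrals over `[0, h]`
  -- and `[r, r + h]` equals that over `[0, r]` and `[h, h + r]`. The averages of these last two
  -- tend to `x` and `U h x`.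
  have hmem : ∀ h : ℝ, 0 < h → (∫ s in (0:ℝ)..h, U s x, x - U h x) ∈ L := by
    intro h hh
    refine (hU.generator _ _).2 ?_
    have h0 := hright 0 le_rfl
    have h1 := h0.sub (hright h hh.le)
    rw [hU.zero] at h1
    refine h1.congr' ?_
    filter_upwards [self_mem_nhdsWithin] with r hr
    have hr : (0:ℝ) < r := hr
    have e : U r (∫ s in (0:ℝ)..h, U s x) = ∫ s in r..(r + h), U s x := by
      have e1 : U r (∫ s in (0:ℝ)..h, U s x) = ∫ s in (0:ℝ)..h, U r (U s x) :=
        (((U r).restrictScalars ℝ).intervalIntegral_comp_comm (hint 0 h le_rfl hh.le)).symm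
      have e2 : ∫ s in (0:ℝ)..h, U r (U s x) = ∫ s in (0:ℝ)..h, U (r + s) x := by
        refine intervalIntegral.integral_congr fun s hs => ?_
        rw [uIcc_of_le hh.le] at hs
        simp [hU.add r s hr.le hs.1]
      rw [e1, e2]
      simpa using intervalIntegral.integral_comp_add_left (a := (0:ℝ)) (b := h)
        (fun s => U s x) r
    rw [e, ← hsm, ← smul_sub, zero_add]
    congr 1
    rw [intervalIntegral.integral_interval_sub_interval_comm (hint _ _ le_rfl hr.le)
      (hint _ _ hh.le (by positivity)) (hint _ _ le_rfl hh.le), add_comm h r]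
  have hlim := hright 0 le_rfl
  rw [hU.zero] at hlim
  refine mem_closure_of_tendsto hlim ?_
  filter_upwards [self_mem_nhdsWithin] with r hr
  refine ⟨(r⁻¹ : ℝ) • (x - U r x), ?_⟩
  have := L.smul_mem ((r⁻¹ : ℝ) : 𝕜) (hmem r hr)
  simpa [hsm] using this

end Semigroup

/-! ### Heat semigroups of the factors and of the product -/

section Heat

open Filter Set

variable {𝕜 HF HM : Type*} [RCLike 𝕜] [NormedAddCommGroup HF] [InnerProductSpace 𝕜 HF]
  [NormedAddCommGroup HM] [InnerProductSpace 𝕜 HM]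

theorem finiteHeat_zero (DF : HF →L[𝕜] HF) : finiteHeat DF 0 = 1 := by
  simp [finiteHeat, NormedSpace.exp_zero]

theorem finiteHeat_add [CompleteSpace HF] (DF : HF →L[𝕜] HF) (s t : ℝ) :
    finiteHeat DF (s + t) = finiteHeat DF s * finiteHeat DF t := by
  have : NormedAlgebra ℚ (HF →L[𝕜] HF) := NormedAlgebra.restrictScalars ℚ 𝕜 _
  rw [finiteHeat, finiteHeat, finiteHeat, ← NormedSpace.exp_add_of_commute]
  · congr 1
    rw [RCLike.ofReal_add, add_smul, neg_add]
  · exact (((Commute.refl _).smul_left _).smul_right _).neg_left.neg_right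

theorem continuous_finiteHeat [CompleteSpace HF] (DF : HF →L[𝕜] HF) :
    Continuous (finiteHeat DF) := by
  have : NormedAlgebra ℚ (HF →L[𝕜] HF) := NormedAlgebra.restrictScalars ℚ 𝕜 _
  unfold finiteHeat
  refine NormedSpace.exp_continuous.comp ?_
  have := RCLike.continuous_ofReal (K := 𝕜)
  fun_prop

theorem tendsto_finiteHeat [CompleteSpace HF] (DF : HF →L[𝕜] HF) :
    Tendsto (fun t : ℝ => ((t⁻¹ : ℝ) : 𝕜) • (1 - finiteHeat DF t)) (𝓝[>] 0)
      (𝓝 (DF ∘L DF)) := by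
  have h := hasDerivAt_exp_smul_const (𝕂 := 𝕜) (-(DF ∘L DF)) (0 : 𝕜)
  rw [hasDerivAt_iff_tendsto_slope] at h
  have h2 : Tendsto (fun t : ℝ => (t : 𝕜)) (𝓝[>] 0) (𝓝[≠] 0) := by
    refine tendsto_nhdsWithin_iff.2 ⟨?_, ?_⟩
    · have : Tendsto (fun t : ℝ => (t : 𝕜)) (𝓝 0) (𝓝 ((0 : ℝ) : 𝕜)) :=
        RCLike.continuous_ofReal.tendsto 0
      rw [RCLike.ofReal_zero] at this
      exact this.mono_left nhdsWithin_le_nhds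
    · filter_upwards [self_mem_nhdsWithin] with t ht
      simpa using ne_of_gt ht
  have h3 := (h.comp h2).neg
  simp only [zero_smul, NormedSpace.exp_zero, one_mul, neg_neg] at h3
  refine h3.congr fun t => ?_
  simp [slope_def_module, finiteHeat, NormedSpace.exp_zero, ← smul_neg]

theorem isSelfAdjoint_finiteHeat [CompleteSpace HF] {DF : HF →L[𝕜] HF} (h : IsSelfAdjoint DF)
    (t : ℝ) : IsSelfAdjoint (finiteHeat DF t) := by
  refine IsSelfAdjoint.exp (IsSelfAdjoint.neg ?_)
  refine IsSelfAdjoint.smul ?_ ?_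
  · rw [isSelfAdjoint_iff, RCLike.star_def, RCLike.conj_ofReal]
  · have := h.pow 2
    rwa [pow_two] at this

/-- Vectors fixed up to a scalar by the heat operators have a positive eigenvalue. -/
theorem finiteHeat_eigenvalue_pos [CompleteSpace HF] {DF : HF →L[𝕜] HF} (h : IsSelfAdjoint DF)
    {t : ℝ} {x : HF} {c : 𝕜} (hx : x ≠ 0) (hc : c ≠ 0) (hcx : finiteHeat DF t x = c • x) :
    ∃ r : ℝ, 0 < r ∧ c = r := by
  -- Since the operator at time `t` is the square of the self-adjoint one at time `t / 2`, the
  -- number `c ‖x‖²` is the squared norm of the half-time image of `x`.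
  have h1 : finiteHeat DF t x = finiteHeat DF (t / 2) (finiteHeat DF (t / 2) x) := by
    rw [← mul_apply_eq_comp, ← finiteHeat_add, add_halves]
  have h2 : inner 𝕜 x (finiteHeat DF t x) =
      inner 𝕜 (finiteHeat DF (t / 2) x) (finiteHeat DF (t / 2) x) := by
    rw [h1]
    exact ((isSelfAdjoint_finiteHeat h (t / 2)).isSymmetric x (finiteHeat DF (t / 2) x)).symm
  rw [hcx, inner_smul_right, inner_self_eq_norm_sq_to_K, inner_self_eq_norm_sq_to_K] at h2
  have hx' : 0 < ‖x‖ := norm_pos_iff.2 hx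
  have hxk : ((‖x‖ : 𝕜)) ≠ 0 := by exact_mod_cast hx'.ne'
  have h3 : c = ((‖finiteHeat DF (t / 2) x‖ ^ 2 / ‖x‖ ^ 2 : ℝ) : 𝕜) := by
    push_cast
    field_simp
    exact h2
  refine ⟨_, lt_of_le_of_ne (by positivity) (fun h0 => hc ?_), h3⟩
  rw [h3, ← h0, RCLike.ofReal_zero]

/-- The heat semigroup of the product is the tensor product of the heat semigroups. -/
theorem product_heat_eq_mapL [CompleteSpace HF] [CompleteSpace HM]
    {DF : HF →L[𝕜] HF} {D : HM →ₗ.[𝕜] HM} {UM : ℝ → HM →L[𝕜] HM}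
    (hUM : IsExpNeg D.square.graph UM)
    {U : ℝ → (HF ⊗[𝕜] HM) →L[𝕜] (HF ⊗[𝕜] HM)} (hU : IsExpNeg (productDiracSq DF D) U)
    {t : ℝ} (ht : 0 ≤ t) : U t = TensorProduct.mapL (finiteHeat DF t) (UM t) := by
  have hdom : ∀ x y, (x, y) ∈ productDiracSq DF D →
      U t x = TensorProduct.mapL (finiteHeat DF t) (UM t) x := by
    intro x y hxy
    refine hU.apply_eq_of_tendsto
      (V := fun t => TensorProduct.mapL (finiteHeat DF t) (UM t)) ?_ ?_ ?_ ?_ ?_ ht hxy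
    · rw [finiteHeat_zero, hUM.zero]
      exact TensorProduct.mapL_id_id
    · intro s t hs ht
      simp only [finiteHeat_add, hUM.add s t hs ht, TensorProduct.mapL_mul]
    · intro x
      induction x with
      | zero => simpa using continuousOn_const
      | add x y hx hy => simp only [map_add]; exact hx.add hy
      | tmul a b =>
        simp only [TensorProduct.mapL_tmul]
        exact TensorProduct.continuous_tmul.comp_continuousOn
          ((((continuous_finiteHeat DF).clm_apply continuous_const).continuousOn).prodMk
            (hUM.continuousOn b))
    · intro t
      obtain ⟨C, hC⟩ := hUM.exists_norm_le t
      obtain ⟨C', hC'⟩ := isCompact_Icc.exists_bound_of_continuousOn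
        (continuous_finiteHeat DF).continuousOn (s := Icc 0 t)
      refine ⟨C' * C, fun s hs => (TensorProduct.norm_mapL_le _ _).trans ?_⟩
      exact mul_le_mul (hC' s hs) (hC s hs) (norm_nonneg _) ((norm_nonneg _).trans (hC' s hs))
    · rintro x y ⟨z, hz⟩
      obtain ⟨rfl, rfl⟩ := Prod.ext_iff.1 hz
      clear hz hxy
      induction z with
      | zero => simp
      | add z w hz hw =>
        refine Tendsto.congr (fun t => ?_) (by simpa only [map_add, Prod.snd_add] using hz.add hw)
        simp only [map_add, Prod.fst_add, smul_sub, smul_add]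
        abel
      | tmul a b =>
        -- Leibniz rule: `a ⊗ b - Ea ⊗ Fb = Ea ⊗ (b - Fb) + (a - Ea) ⊗ b`.
        have h1 := (hUM.generator _ _).1 (D.square.mem_graph b)
        have h2 := ((ContinuousLinearMap.apply 𝕜 HF a).continuous.tendsto _).comp (tendsto_finiteHeat DF)
        have h3 : Tendsto (fun t => finiteHeat DF t a) (𝓝[>] 0) (𝓝 a) := by
          have := ((continuous_finiteHeat DF).clm_apply (continuous_const (y := a))).tendsto 0
          rw [finiteHeat_zero] at this
          exact this.mono_left nhdsWithin_le_nhds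
        have h4 := ((TensorProduct.continuous_tmul (𝕜 := 𝕜)).tendsto _).comp
          (h2.prodMk_nhds (tendsto_const_nhds (x := (b : HM))))
        have h5 := ((TensorProduct.continuous_tmul (𝕜 := 𝕜)).tendsto _).comp (h3.prodMk_nhds h1)
        refine Tendsto.congr (fun t => ?_) (h5.add h4)
        simp only [Function.comp, LinearMap.prod_apply, Function.prod_apply, TensorProduct.map_tmul,
          Submodule.subtype_apply, LinearMap.id_apply, TensorProduct.mapL_tmul,
          ContinuousLinearMap.apply_apply, TensorProduct.tmul_smul, TensorProduct.smul_tmul',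
          TensorProduct.tmul_sub, TensorProduct.sub_tmul, smul_sub, smul_apply,
          sub_apply, one_apply_eq_self]
        abel
  refine ContinuousLinearMap.ext fun z => ?_
  induction z with
  | zero => simp
  | add x y hx hy => simp only [map_add, hx, hy]
  | tmul a b =>
    refine congrFun (Continuous.ext_on hUM.dense_domain (f := fun b => U t (a ⊗ₜ b))
      (g := fun b => TensorProduct.mapL (finiteHeat DF t) (UM t) (a ⊗ₜ b)) ?_ ?_ ?_) b
    · exact (U t).continuous.comp (TensorProduct.mkL 𝕜 HF HM a).continuous
    · exact (ContinuousLinearMap.continuous _).comp (TensorProduct.mkL 𝕜 HF HM a).continuous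
    · rintro b ⟨y, hb⟩
      exact hdom _ _ ⟨a ⊗ₜ ⟨b, LinearPMap.mem_domain_of_mem_graph hb⟩, rfl⟩

end Heat

/-! ### Kraus decompositions and slice maps -/

section CompletelyPositive

variable {𝕜 A B C D : Type*} [RCLike 𝕜] [Ring A] [StarRing A] [Algebra 𝕜 A]
  [Ring B] [StarRing B] [Algebra 𝕜 B] [Ring C] [StarRing C] [Algebra 𝕜 C]
  [Ring D] [StarRing D] [Algebra 𝕜 D]

theorem isPosElem_star_mul_self (b : A) : IsPosElem (star b * b) :=
  AddSubmonoid.subset_closure ⟨b, rfl⟩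

theorem IsPosElem.sum {κ : Type*} (s : Finset κ) {f : κ → A} (h : ∀ k ∈ s, IsPosElem (f k)) :
    IsPosElem (∑ k ∈ s, f k) :=
  AddSubmonoid.sum_mem _ h

theorem isCompletelyPositive_of_star_mul_self {T : A →ₗ[𝕜] B}
    (h : ∀ (n : ℕ) (b : Matrix (Fin n) (Fin n) A), IsPosElem ((star b * b).map T)) :
    IsCompletelyPositive T := by
  intro n x hx
  induction hx using AddSubmonoid.closure_induction with
  | mem x hx =>
    obtain ⟨b, rfl⟩ := hx
    exact h n b
  | zero =>
    rw [Matrix.map_zero _ (map_zero T)]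
    exact AddSubmonoid.zero_mem _
  | add x y _ _ hx hy =>
    rw [Matrix.map_add _ (map_add T)]
    exact AddSubmonoid.add_mem _ hx hy

theorem IsCompletelyPositive.comp {S : B →ₗ[𝕜] C} {T : A →ₗ[𝕜] B}
    (hS : IsCompletelyPositive S) (hT : IsCompletelyPositive T) :
    IsCompletelyPositive (S ∘ₗ T) := by
  intro n x hx
  have := hS n _ (hT n x hx)
  rwa [Matrix.map_map] at this

/-- A linear map with a Kraus type decomposition is completely positive. -/
theorem isCompletelyPositive_of_kraus {κ : Type*} [Fintype κ] {T : A →ₗ[𝕜] B}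
    (S : κ → A →ₗ[𝕜] B) (h : ∀ a b, T (star a * b) = ∑ k, star (S k a) * S k b) :
    IsCompletelyPositive T := by
  refine isCompletelyPositive_of_star_mul_self fun n b => ?_
  have : (star b * b).map T = ∑ k, star (b.map (S k)) * b.map (S k) := by
    ext i j
    rw [Matrix.sum_apply]
    simp only [Matrix.map_apply, Matrix.mul_apply, Matrix.star_apply, map_sum, h]
    exact Finset.sum_comm
  rw [this]
  exact IsPosElem.sum _ fun k _ => isPosElem_star_mul_self _

theorem isCompletelyPositive_of_map_star_mul {T : A →ₗ[𝕜] B}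
    (h : ∀ a b, T (star a * b) = star (T a) * T b) : IsCompletelyPositive T :=
  isCompletelyPositive_of_kraus (fun _ : Unit => T) (by simpa using h)

theorem IsCompletelyPositive.ofReal_smul [StarModule 𝕜 B] {T : A →ₗ[𝕜] B}
    (hT : IsCompletelyPositive T) {r : ℝ} (hr : 0 ≤ r) :
    IsCompletelyPositive ((r : 𝕜) • T) := by
  have h : IsCompletelyPositive ((r : 𝕜) • (LinearMap.id : B →ₗ[𝕜] B)) := by
    refine isCompletelyPositive_of_kraus
      (fun _ : Unit => ((√r : ℝ) : 𝕜) • (LinearMap.id : B →ₗ[𝕜] B)) fun a b => ?_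
    simp [smul_smul, ← RCLike.ofReal_mul, Real.mul_self_sqrt hr]
  exact h.comp hT

/-- The tensor product of a map with Kraus decomposition and a `*`-homomorphism. -/
theorem TensorProduct.map_star_mul [StarModule 𝕜 A] [StarModule 𝕜 B] [StarModule 𝕜 C]
    [StarModule 𝕜 D] {κ : Type*} [Fintype κ] {T : A →ₗ[𝕜] C} {S : κ → A →ₗ[𝕜] C}
    (hT : ∀ a b, T (star a * b) = ∑ k, star (S k a) * S k b) {f : B →ₗ[𝕜] D}
    (hf : ∀ a b, f (star a * b) = star (f a) * f b) (x y : A ⊗[𝕜] B) :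
    TensorProduct.map T f (star x * y) =
      ∑ k, star (TensorProduct.map (S k) f x) * TensorProduct.map (S k) f y := by
  induction x with
  | zero => simp
  | add x x' hx hx' => simp only [star_add, map_add, add_mul, hx, hx', Finset.sum_add_distrib]
  | tmul a b =>
    induction y with
    | zero => simp
    | add y y' hy hy' => simp only [map_add, mul_add, hy, hy', Finset.sum_add_distrib]
    | tmul a' b' =>
      simp [Algebra.TensorProduct.tmul_mul_tmul, hT, hf, TensorProduct.sum_tmul]

theorem TensorProduct.lid_star_mul [StarModule 𝕜 B] (x y : 𝕜 ⊗[𝕜] B) :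
    TensorProduct.lid 𝕜 B (star x * y) =
      star (TensorProduct.lid 𝕜 B x) * TensorProduct.lid 𝕜 B y := by
  induction x with
  | zero => simp
  | add x x' hx hx' => simp only [star_add, map_add, add_mul, hx, hx']
  | tmul a b =>
    induction y with
    | zero => simp
    | add y y' hy hy' => simp only [map_add, mul_add, hy, hy']
    | tmul a' b' =>
      simp only [TensorProduct.star_tmul, Algebra.TensorProduct.tmul_mul_tmul,
        TensorProduct.lid_tmul, star_smul, smul_mul_smul_comm]

theorem TensorProduct.rid_star_mul [StarModule 𝕜 A] (x y : A ⊗[𝕜] 𝕜) :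
    TensorProduct.rid 𝕜 A (star x * y) =
      star (TensorProduct.rid 𝕜 A x) * TensorProduct.rid 𝕜 A y := by
  induction x with
  | zero => simp
  | add x x' hx hx' => simp only [star_add, map_add, add_mul, hx, hx']
  | tmul a b =>
    induction y with
    | zero => simp
    | add y y' hy hy' => simp only [map_add, mul_add, hy, hy']
    | tmul a' b' =>
      simp only [TensorProduct.star_tmul, Algebra.TensorProduct.tmul_mul_tmul,
        TensorProduct.rid_tmul, star_smul, smul_mul_smul_comm]

/-- Slice maps on the left by functionals with a Kraus decomposition are completely positive. -/
theorem isCompletelyPositive_lid_map [StarModule 𝕜 A] [StarModule 𝕜 B] {κ : Type*} [Fintype κ]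
    {ω : A →ₗ[𝕜] 𝕜} {S : κ → A →ₗ[𝕜] 𝕜} (h : ∀ a b, ω (star a * b) = ∑ k, star (S k a) * S k b) :
    IsCompletelyPositive
      ((TensorProduct.lid 𝕜 B).toLinearMap ∘ₗ TensorProduct.map ω LinearMap.id) :=
  (isCompletelyPositive_of_map_star_mul (TensorProduct.lid_star_mul)).comp
    (isCompletelyPositive_of_kraus _ (TensorProduct.map_star_mul h fun _ _ => rfl))

/-- Slice maps on the right by characters are completely positive. -/
theorem isCompletelyPositive_rid_map [StarModule 𝕜 A] [StarModule 𝕜 B]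
    {ω : B →ₗ[𝕜] 𝕜} (h : ∀ a b, ω (star a * b) = star (ω a) * ω b) :
    IsCompletelyPositive
      ((TensorProduct.rid 𝕜 A).toLinearMap ∘ₗ TensorProduct.map LinearMap.id ω) :=
  (isCompletelyPositive_of_map_star_mul (TensorProduct.rid_star_mul)).comp
    (isCompletelyPositive_of_kraus (κ := Unit) _
      (TensorProduct.map_star_mul (S := fun _ => LinearMap.id) (fun _ _ => by simp) h))

theorem isCompletelyPositive_tmul_one [StarModule 𝕜 A] [StarModule 𝕜 B] :
    IsCompletelyPositive ((TensorProduct.mk 𝕜 A B).flip 1) :=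
  isCompletelyPositive_of_map_star_mul fun a b => by simp

theorem isCompletelyPositive_one_tmul [StarModule 𝕜 A] [StarModule 𝕜 B] :
    IsCompletelyPositive (TensorProduct.mk 𝕜 A B 1) :=
  isCompletelyPositive_of_map_star_mul fun a b => by simp

end CompletelyPositive

/-! ### Realisations of tensor products and eigenvalues on the unit -/

section Realization

variable {𝕜 A B H K I J : Type*} [RCLike 𝕜] [Ring A] [Algebra 𝕜 A] [Ring B] [Algebra 𝕜 B]
  [NormedAddCommGroup H] [InnerProductSpace 𝕜 H] [NormedAddCommGroup K] [InnerProductSpace 𝕜 K]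

theorem lid_map_rid_map {A B : Type*} [AddCommGroup A] [Module 𝕜 A] [AddCommGroup B] [Module 𝕜 B]
    (α : A →ₗ[𝕜] 𝕜) (β : B →ₗ[𝕜] 𝕜) (z : A ⊗[𝕜] B) :
    β (TensorProduct.lid 𝕜 B (TensorProduct.map α LinearMap.id z)) =
      α (TensorProduct.rid 𝕜 A (TensorProduct.map LinearMap.id β z)) := by
  induction z with
  | zero => simp
  | add x y hx hy => simp only [map_add, hx, hy]
  | tmul a b => simp [mul_comm]

/-- The coordinates of `z` along a basis of `A` are themselves slices by linear functionals. -/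
theorem TensorProduct.eq_zero_of_lid_map {A B : Type*} [AddCommGroup A] [Module 𝕜 A]
    [AddCommGroup B] [Module 𝕜 B] {z : A ⊗[𝕜] B}
    (h : ∀ α : A →ₗ[𝕜] 𝕜, TensorProduct.lid 𝕜 B (TensorProduct.map α LinearMap.id z) = 0) :
    z = 0 := by
  classical
  refine (TensorProduct.equivFinsuppOfBasisLeft (N := B)
    (Module.Basis.ofVectorSpace 𝕜 A)).map_eq_zero_iff.1 (Finsupp.ext fun k => ?_)
  rw [TensorProduct.equivFinsuppOfBasisLeft_apply]
  exact h _

theorem exists_dual_eq_one {v : H} (hv : v ≠ 0) : ∃ φ : H →ₗ[𝕜] 𝕜, φ v = 1 := by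
  refine ⟨(inner 𝕜 v v)⁻¹ • (innerSL 𝕜 v).toLinearMap, ?_⟩
  simp [hv]

theorem eq_zero_of_forall_dual {v : H} (h : ∀ φ : H →ₗ[𝕜] 𝕜, φ v = 0) : v = 0 :=
  inner_self_eq_zero.1 (h (innerSL 𝕜 v).toLinearMap)

theorem map_rid_map (f : A →ₗ[𝕜] H) (κ : B →ₗ[𝕜] K) (ψ : K →ₗ[𝕜] 𝕜) (z : A ⊗[𝕜] B) :
    f (TensorProduct.rid 𝕜 A (TensorProduct.map LinearMap.id (ψ ∘ₗ κ) z)) =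
      TensorProduct.rid 𝕜 H (TensorProduct.map LinearMap.id ψ (TensorProduct.map f κ z)) := by
  induction z with
  | zero => simp
  | add x y hx hy => simp only [map_add, hx, hy]
  | tmul a b => simp

theorem map_lid_map (f : A →ₗ[𝕜] H) (κ : B →ₗ[𝕜] K) (φ : H →ₗ[𝕜] 𝕜) (z : A ⊗[𝕜] B) :
    κ (TensorProduct.lid 𝕜 B (TensorProduct.map (φ ∘ₗ f) LinearMap.id z)) =
      TensorProduct.lid 𝕜 K (TensorProduct.map φ LinearMap.id (TensorProduct.map f κ z)) := by
  induction z with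
  | zero => simp
  | add x y hx hy => simp only [map_add, hx, hy]
  | tmul a b => simp

/-- The product of two realisations is a realisation of the tensor product. -/
theorem IsRealization.tensorProduct {ι : I → A →ₗ[𝕜] H} {κ : J → B →ₗ[𝕜] K}
    (hι : IsRealization ι) (hκ : IsRealization κ) :
    IsRealization (productRealization ι κ) := by
  intro z hz
  refine TensorProduct.eq_zero_of_lid_map fun α => hκ _ fun j => eq_zero_of_forall_dual (𝕜 := 𝕜) fun ψ => ?_
  rw [← LinearMap.comp_apply, lid_map_rid_map]
  suffices h : TensorProduct.rid 𝕜 A (TensorProduct.map LinearMap.id (ψ ∘ₗ κ j) z) = 0 by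
    rw [h, map_zero]
  refine hι _ fun i => ?_
  rw [map_rid_map]
  have : TensorProduct.map (ι i) (κ j) z = 0 := hz (i, j)
  rw [this, map_zero, map_zero]

variable {ι : I → A →ₗ[𝕜] H} {κ : J → B →ₗ[𝕜] K} {E : H →L[𝕜] H} {F : K →L[𝕜] K}

theorem IsRealization.exists_one_ne_zero [Nontrivial A] (hι : IsRealization ι) :
    ∃ i, ι i 1 ≠ 0 := by
  by_contra! h
  exact one_ne_zero (hι 1 h)

theorem rid_map_tmul (ψ : K →ₗ[𝕜] 𝕜) (x : H) (y : K) :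
    TensorProduct.rid 𝕜 H (TensorProduct.map LinearMap.id ψ (x ⊗ₜ y)) = ψ y • x := by simp

theorem lid_map_tmul (φ : H →ₗ[𝕜] 𝕜) (x : H) (y : K) :
    TensorProduct.lid 𝕜 K (TensorProduct.map φ LinearMap.id (x ⊗ₜ y)) = φ x • y := by simp

/-- If `E ⊗ F` fixes the realised unit, then the realised units are eigenvectors of `E` and `F`
with inverse eigenvalues. -/
theorem exists_eigenvalue_of_fixes_one {i₀ : I} {j₀ : J} (hi : ι i₀ 1 ≠ 0) (hj : κ j₀ 1 ≠ 0)
    (h : ∀ i j, E (ι i 1) ⊗ₜ[𝕜] F (κ j 1) = ι i 1 ⊗ₜ κ j 1) :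
    ∃ c : 𝕜, c ≠ 0 ∧ (∀ i, E (ι i 1) = c • ι i 1) ∧ ∀ j, F (κ j 1) = c⁻¹ • κ j 1 := by
  obtain ⟨φ, hφ⟩ := exists_dual_eq_one (𝕜 := 𝕜) hi
  obtain ⟨ψ, hψ⟩ := exists_dual_eq_one (𝕜 := 𝕜) hj
  have h1 : ∀ i, ψ (F (κ j₀ 1)) • E (ι i 1) = ι i 1 := fun i => by
    rw [← rid_map_tmul, h, rid_map_tmul, hψ, one_smul]
  have h2 : ∀ j, φ (E (ι i₀ 1)) • F (κ j 1) = κ j 1 := fun j => by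
    rw [← lid_map_tmul, h, lid_map_tmul, hφ, one_smul]
  have hd : ψ (F (κ j₀ 1)) ≠ 0 := fun h0 => hi (by rw [← h1 i₀, h0, zero_smul])
  have h3 : ∀ i, E (ι i 1) = (ψ (F (κ j₀ 1)))⁻¹ • ι i 1 := fun i => by
    conv_rhs => rw [← h1 i]
    rw [inv_smul_smul₀ hd]
  have h4 : φ (E (ι i₀ 1)) = (ψ (F (κ j₀ 1)))⁻¹ := by
    rw [h3, map_smul, hφ, smul_eq_mul, mul_one]
  refine ⟨(ψ (F (κ j₀ 1)))⁻¹, inv_ne_zero hd, h3, fun j => ?_⟩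
  conv_rhs => rw [← h2 j, h4]
  rw [inv_smul_smul₀ (inv_ne_zero hd)]

end Realization

/-! ### Recovering the factors from the product -/

section Converse

variable {𝕜 A B H K I J : Type*} [RCLike 𝕜]
  [Ring A] [StarRing A] [Algebra 𝕜 A] [Ring B] [StarRing B] [Algebra 𝕜 B]
  [NormedAddCommGroup H] [InnerProductSpace 𝕜 H] [NormedAddCommGroup K] [InnerProductSpace 𝕜 K]

/-- Vector states of a finite dimensional representation have a Kraus decomposition. -/
theorem exists_kraus_state [CompleteSpace H] [FiniteDimensional 𝕜 H] [Nontrivial H]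
    (π : A →⋆ₐ[𝕜] (H →L[𝕜] H)) :
    ∃ (χ : A →ₗ[𝕜] 𝕜) (S : Fin (Module.finrank 𝕜 H) → A →ₗ[𝕜] 𝕜),
      (∀ a b, χ (star a * b) = ∑ k, star (S k a) * S k b) ∧ χ 1 = 1 := by
  obtain ⟨x, hx⟩ := exists_ne (0 : H)
  obtain ⟨v, hv⟩ : ∃ v : H, ‖v‖ = 1 := ⟨_, norm_smul_inv_norm (𝕜 := 𝕜) hx⟩
  let w : H → A →ₗ[𝕜] 𝕜 := fun u => (innerSL 𝕜 u).toLinearMap ∘ₗ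
    (ContinuousLinearMap.apply 𝕜 H v).toLinearMap ∘ₗ π.toAlgHom.toLinearMap
  have hw : ∀ u a, w u a = inner 𝕜 u (π a v) := fun _ _ => rfl
  refine ⟨w v, fun k => w (stdOrthonormalBasis 𝕜 H k), fun a b => ?_, ?_⟩
  -- Here `χ (a⋆ b)` is the inner product of `π a v` and `π b v`; Parseval in an orthonormal basis
  -- is the Kraus decomposition.
  · simp only [hw, map_mul, map_star, mul_apply_eq_comp]
    rw [ContinuousLinearMap.star_eq_adjoint, ContinuousLinearMap.adjoint_inner_right,
      ← (stdOrthonormalBasis 𝕜 H).sum_inner_mul_inner]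
    simp [RCLike.star_def, inner_conj_symm]
  · rw [hw, map_one, one_apply_eq_self, inner_self_eq_norm_sq_to_K, hv]
    simp

variable [StarModule 𝕜 A] [StarModule 𝕜 B] {ι : I → A →ₗ[𝕜] H} {κ : J → B →ₗ[𝕜] K}
  {E : H →L[𝕜] H} {F : K →L[𝕜] K}
  {T : A ⊗[𝕜] B →ₗ[𝕜] A ⊗[𝕜] B}

/-- The left marginal of a completely positive extension of `E ⊗ F`. -/
theorem exists_isCompletelyPositive_left (hι : IsRealization ι) (hκ : IsRealization κ)
    (hT : ∀ p z, productRealization ι κ p (T z) =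
      TensorProduct.mapL E F (productRealization ι κ p z))
    (hTpos : IsCompletelyPositive T) {j₀ : J} (hj : κ j₀ 1 ≠ 0) {r : ℝ} (hr : 0 < r)
    (hF : ∀ j, F (κ j 1) = (r : 𝕜)⁻¹ • κ j 1)
    {χ : B →ₗ[𝕜] 𝕜} (hχ : ∀ a b, χ (star a * b) = star (χ a) * χ b) (hχ1 : χ 1 = 1) :
    ∃ S : A →ₗ[𝕜] A, (∀ i a, ι i (S a) = E (ι i a)) ∧ IsCompletelyPositive S := by
  have hr' : (r : 𝕜) ≠ 0 := by exact_mod_cast hr.ne'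
  have key : ∀ i j a, TensorProduct.map (ι i) (κ j) (T (a ⊗ₜ 1)) =
      (r : 𝕜)⁻¹ • (E (ι i a) ⊗ₜ κ j 1) := fun i j a => by
    refine (hT (i, j) _).trans ?_
    simp [productRealization, hF]
  obtain ⟨ψ, hψ⟩ := exists_dual_eq_one (𝕜 := 𝕜) hj
  -- A slice by `ψ ∘ κ j₀` shows that `E` preserves the realised algebra. This functional need not
  -- be positive, so complete positivity is obtained afterwards by slicing with `χ`, which gives the
  -- same element once `T (a ⊗ 1)` is known to be a multiple of `a' ⊗ 1`.
  have hex : ∀ a, ∃ a', ∀ i, ι i a' = E (ι i a) := fun a => by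
    refine ⟨(r : 𝕜) • TensorProduct.rid 𝕜 A
      (TensorProduct.map LinearMap.id (ψ ∘ₗ κ j₀) (T (a ⊗ₜ 1))), fun i => ?_⟩
    rw [map_smul, map_rid_map, key, map_smul, map_smul, rid_map_tmul, hψ, one_smul,
      smul_inv_smul₀ hr']
  refine ⟨(r : 𝕜) • (((TensorProduct.rid 𝕜 A).toLinearMap ∘ₗ TensorProduct.map LinearMap.id χ) ∘ₗ
    T ∘ₗ (TensorProduct.mk 𝕜 A B).flip 1), fun i a => ?_,
    ((isCompletelyPositive_rid_map hχ).comp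
      (hTpos.comp isCompletelyPositive_tmul_one)).ofReal_smul hr.le⟩
  obtain ⟨a', ha'⟩ := hex a
  have h1 : T (a ⊗ₜ 1) = (r : 𝕜)⁻¹ • (a' ⊗ₜ 1) := by
    refine sub_eq_zero.1 (hι.tensorProduct hκ _ fun p => sub_eq_zero.1 ?_)
    rw [map_sub, sub_zero, sub_eq_zero]
    refine (key p.1 p.2 a).trans ?_
    simp [productRealization, ha']
  rw [← ha' i]
  simp [h1, hχ1, hr', smul_smul]

/-- The right marginal of a completely positive extension of `E ⊗ F`. -/
theorem exists_isCompletelyPositive_right (hι : IsRealization ι) (hκ : IsRealization κ)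
    (hT : ∀ p z, productRealization ι κ p (T z) =
      TensorProduct.mapL E F (productRealization ι κ p z))
    (hTpos : IsCompletelyPositive T) {i₀ : I} (hi : ι i₀ 1 ≠ 0) {r : ℝ} (hr : 0 < r)
    (hE : ∀ i, E (ι i 1) = (r : 𝕜) • ι i 1) {N : Type*} [Fintype N]
    {χ : A →ₗ[𝕜] 𝕜} {S : N → A →ₗ[𝕜] 𝕜} (hχ : ∀ a b, χ (star a * b) = ∑ k, star (S k a) * S k b)
    (hχ1 : χ 1 = 1) :
    ∃ S : B →ₗ[𝕜] B, (∀ j b, κ j (S b) = F (κ j b)) ∧ IsCompletelyPositive S := by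
  have hr' : (r : 𝕜) ≠ 0 := by exact_mod_cast hr.ne'
  have key : ∀ i j b, TensorProduct.map (ι i) (κ j) (T (1 ⊗ₜ b)) =
      (r : 𝕜) • (ι i 1 ⊗ₜ F (κ j b)) := fun i j b => by
    refine (hT (i, j) _).trans ?_
    simp [productRealization, hE, TensorProduct.smul_tmul']
  obtain ⟨φ, hφ⟩ := exists_dual_eq_one (𝕜 := 𝕜) hi
  have hex : ∀ b, ∃ b', ∀ j, κ j b' = F (κ j b) := fun b => by
    refine ⟨(r : 𝕜)⁻¹ • TensorProduct.lid 𝕜 B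
      (TensorProduct.map (φ ∘ₗ ι i₀) LinearMap.id (T (1 ⊗ₜ b))), fun j => ?_⟩
    rw [map_smul, map_lid_map, key, map_smul, map_smul, lid_map_tmul, hφ, one_smul,
      inv_smul_smul₀ hr']
  refine ⟨((r⁻¹ : ℝ) : 𝕜) • (((TensorProduct.lid 𝕜 B).toLinearMap ∘ₗ
    TensorProduct.map χ LinearMap.id) ∘ₗ T ∘ₗ TensorProduct.mk 𝕜 A B 1), fun j b => ?_,
    ((isCompletelyPositive_lid_map hχ).comp
      (hTpos.comp isCompletelyPositive_one_tmul)).ofReal_smul (inv_nonneg.2 hr.le)⟩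
  obtain ⟨b', hb'⟩ := hex b
  have h1 : T (1 ⊗ₜ b) = (r : 𝕜) • (1 ⊗ₜ b') := by
    refine sub_eq_zero.1 (hι.tensorProduct hκ _ fun p => sub_eq_zero.1 ?_)
    rw [map_sub, sub_zero, sub_eq_zero]
    refine (key p.1 p.2 b).trans ?_
    simp [productRealization, hb']
  rw [← hb' j]
  simp only [LinearMap.smul_apply, LinearMap.comp_apply, TensorProduct.mk_apply, h1, map_smul,
    LinearEquiv.coe_coe, TensorProduct.map_tmul, TensorProduct.lid_tmul, hχ1, one_smul,
    LinearMap.id_apply, RCLike.ofReal_inv, inv_smul_smul₀ hr']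

end Converse

/-! ### Square roots in closed `*`-subalgebras -/

section SquareRoot

open Filter

/-- The scalar majorant of the iteration for the square root. -/
noncomputable def sqrtMajorant : ℕ → ℝ
  | 0 => 0
  | k + 1 => (1 + sqrtMajorant k ^ 2) / 2

/-- The iteration `y ↦ (a + y²) / 2`, with limit `1 - √(1 - a)`. -/
noncomputable def sqrtIterate (𝕜 : Type*) {E : Type*} [RCLike 𝕜] [Ring E] [Algebra 𝕜 E] (a : E) :
    ℕ → E
  | 0 => 0
  | k + 1 => (2⁻¹ : 𝕜) • (a + sqrtIterate 𝕜 a k * sqrtIterate 𝕜 a k)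

theorem sqrtMajorant_mem (k : ℕ) : 0 ≤ sqrtMajorant k ∧ sqrtMajorant k ≤ 1 := by
  induction k with
  | zero => simp [sqrtMajorant]
  | succ k ih =>
    rw [sqrtMajorant]
    exact ⟨by positivity, by nlinarith [ih.1, ih.2]⟩

theorem sqrtMajorant_le_succ (k : ℕ) : sqrtMajorant k ≤ sqrtMajorant (k + 1) := by
  rw [sqrtMajorant]
  nlinarith [sq_nonneg (1 - sqrtMajorant k)]

theorem summable_sqrtMajorant : Summable fun k => sqrtMajorant (k + 1) - sqrtMajorant k :=
  summable_of_sum_range_le (c := 1) (fun k => sub_nonneg.2 (sqrtMajorant_le_succ k)) fun n => by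
    rw [Finset.sum_range_sub]
    linarith [(sqrtMajorant_mem n).2, (sqrtMajorant_mem 0).1]

variable {𝕜 E : Type*} [RCLike 𝕜] [NormedRing E] [NormedAlgebra 𝕜 E]

theorem commute_sqrtIterate (a : E) (k : ℕ) : Commute a (sqrtIterate 𝕜 a k) := by
  induction k with
  | zero => exact Commute.zero_right a
  | succ k ih => exact ((Commute.refl a).add_right (ih.mul_right ih)).smul_right _

theorem norm_sqrtIterate_le {a : E} (ha : ‖a‖ ≤ 1) (k : ℕ) :
    ‖sqrtIterate 𝕜 a k‖ ≤ sqrtMajorant k := by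
  induction k with
  | zero => simp [sqrtIterate, sqrtMajorant]
  | succ k ih =>
    rw [sqrtIterate, sqrtMajorant, norm_smul, norm_inv, RCLike.norm_ofNat]
    have h1 : ‖a + sqrtIterate 𝕜 a k * sqrtIterate 𝕜 a k‖ ≤ 1 + sqrtMajorant k ^ 2 :=
      (norm_add_le _ _).trans (add_le_add ha ((norm_mul_le _ _).trans (by
        rw [pow_two]
        exact mul_le_mul ih ih (norm_nonneg _) (sqrtMajorant_mem k).1)))
    linarith

/-- All iterates commute with `a`, so consecutive ones commute and the next difference factors as
`(z + y)(z - y) / 2`. The majorant satisfies the same identity, and its increments telescope below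
`1`. -/
theorem norm_sqrtIterate_sub_le {a : E} (ha : ‖a‖ ≤ 1) (k : ℕ) :
    ‖sqrtIterate 𝕜 a (k + 1) - sqrtIterate 𝕜 a k‖ ≤ sqrtMajorant (k + 1) - sqrtMajorant k := by
  induction k with
  | zero => simpa [sqrtIterate, sqrtMajorant] using norm_sqrtIterate_le (𝕜 := 𝕜) ha 1
  | succ k ih =>
    set y := sqrtIterate 𝕜 a k with hy
    set z := sqrtIterate 𝕜 a (k + 1) with hz
    have hcomm : Commute z y := by
      rw [hz, sqrtIterate]
      exact ((commute_sqrtIterate a k).add_left ((Commute.refl y).mul_left (.refl y))).smul_left _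
    have e : sqrtIterate 𝕜 a (k + 1 + 1) - z = (2⁻¹ : 𝕜) • ((z + y) * (z - y)) := by
      have hz' : z = (2⁻¹ : 𝕜) • (a + y * y) := rfl
      have e' : sqrtIterate 𝕜 a (k + 1 + 1) = (2⁻¹ : 𝕜) • (a + z * z) := rfl
      have e'' : (2⁻¹ : 𝕜) • (a + z * z) - z =
        (2⁻¹ : 𝕜) • (a + z * z) - (2⁻¹ : 𝕜) • (a + y * y) := congrArg _ hz'
      rw [← hcomm.mul_self_sub_mul_self_eq, e', e'', ← smul_sub, add_sub_add_left_eq_sub]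
    have h1 : ‖z + y‖ ≤ sqrtMajorant (k + 1) + sqrtMajorant k :=
      (norm_add_le _ _).trans (add_le_add (norm_sqrtIterate_le ha _) (norm_sqrtIterate_le ha _))
    have h2 := (norm_mul_le (z + y) (z - y)).trans
      (mul_le_mul h1 ih (norm_nonneg _) ((norm_nonneg _).trans h1))
    have h3 : sqrtMajorant (k + 1 + 1) = (1 + sqrtMajorant (k + 1) ^ 2) / 2 := rfl
    have h4 : sqrtMajorant (k + 1) = (1 + sqrtMajorant k ^ 2) / 2 := rfl
    rw [e, norm_smul, norm_inv, RCLike.norm_ofNat, h3]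
    nlinarith

variable [CompleteSpace E] [StarRing E] [ContinuousStar E] [StarModule 𝕜 E]

/-- A self-adjoint element `f` with `‖1 - f‖ ≤ 1` has a square root in each closed `*`-subalgebra
containing it. -/
theorem StarSubalgebra.exists_star_mul_self_eq (S : StarSubalgebra 𝕜 E)
    (hS : IsClosed (S : Set E)) {f : E} (hf : f ∈ S) (hsa : star f = f) (hnorm : ‖1 - f‖ ≤ 1) :
    ∃ g ∈ S, star g * g = f := by
  set y := sqrtIterate 𝕜 (1 - f)
  have hy : ∀ k, y k ∈ S ∧ star (y k) = y k := fun k => by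
    induction k with
    | zero => exact ⟨S.zero_mem, star_zero E⟩
    | succ k ih =>
      refine ⟨S.smul_mem (S.add_mem (S.sub_mem S.one_mem hf) (S.mul_mem ih.1 ih.1)) _, ?_⟩
      change star ((2⁻¹ : 𝕜) • (1 - f + y k * y k)) = (2⁻¹ : 𝕜) • (1 - f + y k * y k)
      simp [star_smul, hsa, ih.2]
  obtain ⟨l, hl⟩ := cauchySeq_tendsto_of_complete (cauchySeq_of_dist_le_of_summable (f := y) _
    (fun k => by
      rw [dist_comm, dist_eq_norm]
      exact norm_sqrtIterate_sub_le (𝕜 := 𝕜) hnorm k) summable_sqrtMajorant)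
  have hlS : l ∈ S := hS.mem_of_tendsto hl (Eventually.of_forall fun k => (hy k).1)
  have hlsa : star l = l := by
    refine tendsto_nhds_unique ((continuous_star.tendsto l).comp hl) (hl.congr fun k => ?_)
    exact (hy k).2.symm
  have hfix : l = (2⁻¹ : 𝕜) • (1 - f + l * l) :=
    tendsto_nhds_unique (hl.comp (tendsto_add_atTop_nat 1))
      ((tendsto_const_nhds.add (hl.mul hl)).const_smul (2⁻¹ : 𝕜))
  -- The fixed point equation `2 l = (1 - f) + l²` says exactly that `(1 - l)² = f`.
  refine ⟨1 - l, S.sub_mem S.one_mem hlS, ?_⟩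
  have h2 : l + l = 1 - f + l * l := by
    have := congrArg (fun z => (2 : 𝕜) • z) hfix
    simpa only [smul_inv_smul₀ (two_ne_zero' 𝕜), two_smul] using this
  rw [star_sub, star_one, hlsa]
  have : (1 - l) * (1 - l) = 1 - (l + l) + l * l := by noncomm_ring
  rw [this, h2]
  abel

-- Writing `A = b⋆ b` with `‖b‖ ≤ 1`, one has `‖x - b⋆ b x‖² = ‖x‖² - 2 ‖b x‖² + ‖b⋆ b x‖²`, and the
-- last term is at most `‖b x‖²`.
open scoped Matrix.Norms.L2Operator MatrixOrder ComplexOrder in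
theorem Matrix.PosSemidef.norm_one_sub_le {N : Type*} [Fintype N] [DecidableEq N]
    {A : Matrix N N 𝕜} (hA : A.PosSemidef) (h : ‖A‖ ≤ 1) : ‖1 - A‖ ≤ 1 := by
  obtain ⟨B, rfl⟩ := CStarAlgebra.nonneg_iff_eq_star_mul_self.1 hA.nonneg
  rw [CStarRing.norm_star_mul_self] at h
  rw [Matrix.cstar_norm_def, map_sub, map_mul, map_star, map_one]
  rw [Matrix.cstar_norm_def] at h
  set b := Matrix.toEuclideanCLM (n := N) (𝕜 := 𝕜) B
  refine ContinuousLinearMap.opNorm_le_bound _ zero_le_one fun x => ?_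
  rw [one_mul]
  refine (pow_le_pow_iff_left₀ (norm_nonneg _) (norm_nonneg _) two_ne_zero).1 ?_
  have h1 : ‖star b (b x)‖ ≤ ‖b x‖ := by
    have hb : ‖star b‖ ≤ 1 := by
      rw [ContinuousLinearMap.star_eq_adjoint, LinearIsometryEquiv.norm_map]
      nlinarith [norm_nonneg b]
    simpa using (star b).le_of_opNorm_le hb (b x)
  have h2 : inner 𝕜 x (star b (b x)) = ((‖b x‖ ^ 2 : ℝ) : 𝕜) := by
    rw [ContinuousLinearMap.star_eq_adjoint, ContinuousLinearMap.adjoint_inner_right,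
      inner_self_eq_norm_sq_to_K]
    push_cast
    rfl
  rw [_root_.sub_apply, one_apply_eq_self, mul_apply_eq_comp, @norm_sub_sq 𝕜, h2, RCLike.ofReal_re]
  nlinarith [norm_nonneg (b x), norm_nonneg (star b (b x))]

end SquareRoot

/-! ### Matrices over `A ⊗ B` as larger matrices over `B` -/

section Flatten

variable {𝕜 A B : Type*} [RCLike 𝕜] [Ring A] [StarRing A] [Algebra 𝕜 A]
  [Ring B] [Algebra 𝕜 B] {N : Type*} [Fintype N] [DecidableEq N] (π : A →⋆ₐ[𝕜] Matrix N N 𝕜)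

/-- The matrix coefficient `a ↦ π(a)_{kl}`. -/
def matrixCoeff (k l : N) : A →ₗ[𝕜] 𝕜 :=
  Matrix.entryLinearMap 𝕜 𝕜 k l ∘ₗ π.toAlgHom.toLinearMap

variable (B) in
/-- The matrix coefficient `a ⊗ b ↦ π(a)_{kl} b`. -/
noncomputable def tensorCoeff (k l : N) : A ⊗[𝕜] B →ₗ[𝕜] B :=
  (TensorProduct.lid 𝕜 B).toLinearMap ∘ₗ TensorProduct.map (matrixCoeff π k l) LinearMap.id

theorem tensorCoeff_tmul (k l : N) (a : A) (b : B) :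
    tensorCoeff B π k l (a ⊗ₜ b) = π a k l • b := rfl

theorem tensorCoeff_mul (k l : N) (x y : A ⊗[𝕜] B) :
    tensorCoeff B π k l (x * y) = ∑ p, tensorCoeff B π k p x * tensorCoeff B π p l y := by
  induction x with
  | zero => simp
  | add x x' hx hx' => simp only [map_add, add_mul, hx, hx', Finset.sum_add_distrib]
  | tmul a b =>
    induction y with
    | zero => simp
    | add y y' hy hy' => simp only [map_add, mul_add, hy, hy', Finset.sum_add_distrib]
    | tmul a' b' =>
      simp only [Algebra.TensorProduct.tmul_mul_tmul, tensorCoeff_tmul, map_mul, Matrix.mul_apply,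
        Finset.sum_smul, smul_mul_smul_comm]

theorem tensorCoeff_one (k l : N) :
    tensorCoeff B π k l 1 = (1 : Matrix N N B) k l := by
  rw [Algebra.TensorProduct.one_def, tensorCoeff_tmul, map_one, Matrix.one_apply, Matrix.one_apply]
  split_ifs <;> simp

variable [StarModule 𝕜 A] [StarRing B] [StarModule 𝕜 B]

theorem tensorCoeff_star (k l : N) (x : A ⊗[𝕜] B) :
    tensorCoeff B π k l (star x) = star (tensorCoeff B π l k x) := by
  induction x with
  | zero => simp
  | add x x' hx hx' => simp only [star_add, map_add, hx, hx']
  | tmul a b =>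
    simp only [TensorProduct.star_tmul, tensorCoeff_tmul, map_star, star_smul, Matrix.star_apply]

variable (B) in
/-- The `*`-homomorphism `Mat_n(A ⊗ B) → Mat_{n × N}(B)` induced by `π : A → Mat_N(𝕜)`. -/
noncomputable def flatten (n : Type*) [Fintype n] [DecidableEq n] :
    Matrix n n (A ⊗[𝕜] B) →⋆ₐ[𝕜] Matrix (n × N) (n × N) B where
  toFun X := Matrix.of fun p q => tensorCoeff B π p.2 q.2 (X p.1 q.1)
  map_one' := by
    ext p q
    simp only [Matrix.of_apply, Matrix.one_apply, Prod.ext_iff]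
    by_cases h : p.1 = q.1
    · simp [h, tensorCoeff_one, Matrix.one_apply]
    · simp [h]
  map_mul' X Y := by
    ext p q
    simp only [Matrix.of_apply, Matrix.mul_apply, map_sum, tensorCoeff_mul, Fintype.sum_prod_type]
  map_zero' := by ext; simp
  map_add' X Y := by ext; simp
  commutes' r := by
    ext p q
    simp only [Matrix.of_apply, Algebra.algebraMap_eq_smul_one, Matrix.smul_apply, map_smul,
      Matrix.one_apply, Prod.ext_iff]
    by_cases h : p.1 = q.1
    · simp [h, tensorCoeff_one, Matrix.one_apply]
    · simp [h]
  map_star' X := by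
    ext p q
    simp [Matrix.star_apply, tensorCoeff_star]

theorem flatten_apply {n : Type*} [Fintype n] [DecidableEq n] (X : Matrix n n (A ⊗[𝕜] B))
    (p q : n × N) : flatten B π n X p q = tensorCoeff B π p.2 q.2 (X p.1 q.1) := rfl

variable (B) in
/-- The left inverse of `flatten` attached to a linear map `Mat_N(𝕜) → A`. -/
noncomputable def unflatten (lam : Matrix N N 𝕜 →ₗ[𝕜] A) (n : Type*)
    (G : Matrix (n × N) (n × N) B) : Matrix n n (A ⊗[𝕜] B) :=
  Matrix.of fun i j => ∑ k, ∑ l, lam (Matrix.single k l 1) ⊗ₜ G (i, k) (j, l)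

theorem unflatten_flatten {lam : Matrix N N 𝕜 →ₗ[𝕜] A} (h : ∀ a, lam (π a) = a)
    {n : Type*} [Fintype n] [DecidableEq n] (X : Matrix n n (A ⊗[𝕜] B)) :
    unflatten B lam n (flatten B π n X) = X := by
  ext i j
  simp only [unflatten, flatten_apply, Matrix.of_apply]
  generalize X i j = x
  induction x with
  | zero => simp
  | add x y hx hy => simp only [map_add, TensorProduct.tmul_add, Finset.sum_add_distrib, hx, hy]
  | tmul a b =>
    simp only [tensorCoeff_tmul, ← TensorProduct.smul_tmul, ← TensorProduct.sum_tmul]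
    congr 1
    conv_rhs => rw [← h a, Matrix.matrix_eq_sum_single (π a)]
    simp only [map_sum]
    refine Finset.sum_congr rfl fun k _ => Finset.sum_congr rfl fun l _ => ?_
    rw [← map_smul, Matrix.smul_single, smul_eq_mul, mul_one]

end Flatten

/-! ### Pointwise positivity and tensor products of completely positive maps -/

section Positive

theorem IsPosElem.map_starRingHom {A B : Type*} [Ring A] [StarRing A] [Ring B] [StarRing B]
    (f : A →+ B) (hf : ∀ b, f (star b * b) = star (f b) * f b) {x : A} (hx : IsPosElem x) :
    IsPosElem (f x) := by
  induction hx using AddSubmonoid.closure_induction with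
  | mem x hx =>
    obtain ⟨b, rfl⟩ := hx
    change IsPosElem (f (star b * b))
    rw [hf]
    exact isPosElem_star_mul_self _
  | zero => rw [map_zero]; exact AddSubmonoid.zero_mem _
  | add x y _ _ hx hy => rw [map_add]; exact AddSubmonoid.add_mem _ hx hy

theorem IsPosElem.map_starAlgHom {𝕜 A B : Type*} [RCLike 𝕜] [Ring A] [StarRing A] [Algebra 𝕜 A]
    [Ring B] [StarRing B] [Algebra 𝕜 B] (f : A →⋆ₐ[𝕜] B) {x : A} (hx : IsPosElem x) :
    IsPosElem (f x) :=
  hx.map_starRingHom (f : A →+ B) fun b => by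
    change f (star b * b) = star (f b) * f b
    rw [map_mul, map_star]

/-- Complete positivity gives positivity on matrices with arbitrary finite index type. -/
theorem IsCompletelyPositive.map_isPosElem {𝕜 A B : Type*} [RCLike 𝕜]
    [Ring A] [StarRing A] [Algebra 𝕜 A] [Ring B] [StarRing B] [Algebra 𝕜 B]
    {T : A →ₗ[𝕜] B} (hT : IsCompletelyPositive T) {ι : Type*} [Fintype ι] [DecidableEq ι]
    {x : Matrix ι ι A} (hx : IsPosElem x) : IsPosElem (x.map T) := by
  let e := Fintype.equivFin ι
  have h1 : IsPosElem (x.submatrix e.symm e.symm) :=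
    hx.map_starRingHom (f := (Matrix.reindexLinearEquiv ℕ A e e).toLinearMap.toAddMonoidHom)
      fun b => by
        simp [Matrix.star_eq_conjTranspose, Matrix.conjTranspose_submatrix,
          Matrix.submatrix_mul_equiv]
  have h2 := (hT _ _ h1).map_starRingHom
    (f := (Matrix.reindexLinearEquiv ℕ B e.symm e.symm).toLinearMap.toAddMonoidHom)
      fun b => by
        simp [Matrix.star_eq_conjTranspose, Matrix.conjTranspose_submatrix,
          Matrix.submatrix_mul_equiv]
  convert h2 using 1
  ext i j
  simp

open scoped ComplexOrder in
theorem IsPosElem.posSemidef {𝕜 N : Type*} [RCLike 𝕜] [Fintype N] [DecidableEq N]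
    {x : Matrix N N 𝕜} (hx : IsPosElem x) : x.PosSemidef := by
  induction hx using AddSubmonoid.closure_induction with
  | mem x hx =>
    obtain ⟨b, rfl⟩ := hx
    exact Matrix.posSemidef_conjTranspose_mul_self b
  | zero => exact Matrix.PosSemidef.zero
  | add x y _ _ hx hy => exact hx.add hy

variable {𝕜 M : Type*} [RCLike 𝕜] [TopologicalSpace M]

/-- Matrices of continuous functions are continuous matrix valued functions. -/
def matrixValued (𝕜 M N : Type*) [RCLike 𝕜] [TopologicalSpace M] [Fintype N] [DecidableEq N] :
    Matrix N N C(M, 𝕜) →⋆ₐ[𝕜] C(M, Matrix N N 𝕜) where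
  toFun X := ⟨fun m => X.map fun f => f m,
    continuous_matrix fun i j => (X i j).continuous⟩
  map_one' := by ext m i j; by_cases h : i = j <;> simp [h]
  map_mul' X Y := by ext m i j; simp [Matrix.mul_apply]
  map_zero' := by ext; simp
  map_add' X Y := by ext; simp
  commutes' r := by
    ext m i j
    by_cases h : i = j <;> simp [Algebra.algebraMap_eq_smul_one, h]
  map_star' X := by ext m i j; simp [Matrix.star_apply]

theorem matrixValued_apply {N : Type*} [Fintype N] [DecidableEq N]
    (X : Matrix N N C(M, 𝕜)) (m : M) : matrixValued 𝕜 M N X m = X.map fun f => f m := rfl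

open scoped ComplexOrder

theorem IsPosElem.posSemidef_eval {N : Type*} [Fintype N] [DecidableEq N]
    {X : Matrix N N C(M, 𝕜)} (hX : IsPosElem X) (m : M) :
    (matrixValued 𝕜 M N X m).PosSemidef :=
  (hX.map_starRingHom (AddMonoidHom.mk' (fun X => matrixValued 𝕜 M N X m)
    fun X Y => by rw [map_add]; rfl) fun b => by
      change matrixValued 𝕜 M N (star b * b) m = _
      rw [map_mul, map_star]
      rfl).posSemidef

variable {A : Type*} [Ring A] [StarRing A] [Algebra 𝕜 A] [StarModule 𝕜 A]
  {N : Type*} [Fintype N] [DecidableEq N] {π : A →⋆ₐ[𝕜] Matrix N N 𝕜}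

theorem IsPosElem.posSemidef_flatten {n : Type*} [Fintype n] [DecidableEq n]
    {X : Matrix n n (A ⊗[𝕜] C(M, 𝕜))} (hX : IsPosElem X) (m : M) :
    (matrixValued 𝕜 M (n × N) (flatten C(M, 𝕜) π n X) m).PosSemidef :=
  (hX.map_starAlgHom (flatten C(M, 𝕜) π n)).posSemidef_eval m

theorem flatten_unflatten_apply (lam : Matrix N N 𝕜 →ₗ[𝕜] A) {B : Type*} [Ring B] [StarRing B]
    [Algebra 𝕜 B] [StarModule 𝕜 B] {n : Type*} [Fintype n] [DecidableEq n]
    (G : Matrix (n × N) (n × N) B) (p q : n × N) :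
    flatten B π n (unflatten B lam n G) p q =
      ∑ k, ∑ l, π (lam (Matrix.single k l 1)) p.2 q.2 • G (p.1, k) (q.1, l) := by
  simp only [flatten_apply, unflatten, Matrix.of_apply, map_sum, tensorCoeff_tmul]

open scoped Matrix.Norms.L2Operator

/-- For a linear left inverse `lam` of `π`, the map `π ∘ lam` is a projection onto the range of `π`.
Applied blockwise it cuts out the range by linear equations in the entries at each point, which are
closed conditions. -/
theorem isClosed_range_matrixValued_flatten [CompactSpace M] (hπ : Function.Injective π)
    (n : Type*) [Fintype n] [DecidableEq n] :
    IsClosed (((matrixValued 𝕜 M (n × N)).comp (flatten C(M, 𝕜) π n)).range :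
      Set C(M, Matrix (n × N) (n × N) 𝕜)) := by
  obtain ⟨lam, hlam⟩ := LinearMap.exists_leftInverse_of_injective π.toAlgHom.toLinearMap
    (LinearMap.ker_eq_bot.2 hπ)
  replace hlam : ∀ a, lam (π a) = a := fun a => LinearMap.congr_fun hlam a
  have : (((matrixValued 𝕜 M (n × N)).comp (flatten C(M, 𝕜) π n)).range :
      Set C(M, Matrix (n × N) (n × N) 𝕜)) = {G | ∀ m p q,
        ∑ k, ∑ l, π (lam (Matrix.single k l 1)) p.2 q.2 • G m (p.1, k) (q.1, l) = G m p q} := by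
    ext G
    constructor
    · rintro ⟨X, rfl⟩ m p q
      have := congrArg (fun f : C(M, 𝕜) => f m)
        (flatten_unflatten_apply (π := π) lam (flatten C(M, 𝕜) π n X) p q)
      rw [unflatten_flatten π hlam] at this
      simpa [matrixValued_apply] using this.symm
    · intro hG
      let G' : Matrix (n × N) (n × N) C(M, 𝕜) :=
        Matrix.of fun p q => ⟨fun m => G m p q, G.continuous.matrix_elem p q⟩
      refine ⟨unflatten C(M, 𝕜) lam n G', ?_⟩
      ext m p q
      change flatten C(M, 𝕜) π n (unflatten C(M, 𝕜) lam n G') p q m = _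
      rw [flatten_unflatten_apply, ← hG m p q]
      simp [G']
  rw [this]
  simp only [Set.ofPred_forall]
  refine isClosed_iInter fun m => isClosed_iInter fun p => isClosed_iInter fun q => ?_
  have hc : ∀ p q, Continuous fun G : C(M, Matrix (n × N) (n × N) 𝕜) => G m p q := fun p q =>
    (continuous_eval_const m).matrix_elem p q
  exact isClosed_eq (continuous_finsetSum _ fun k _ => continuous_finsetSum _ fun l _ =>
    by
      have := hc (p.1, k) (q.1, l)
      fun_prop) (hc p q)

/-- Positivity in `Mat_n(A ⊗ C(M))` is pointwise positivity. -/
theorem isPosElem_of_posSemidef_flatten [CompactSpace M] (hπ : Function.Injective π)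
    {n : Type*} [Fintype n] [DecidableEq n] {X : Matrix n n (A ⊗[𝕜] C(M, 𝕜))}
    (hX : ∀ m, (matrixValued 𝕜 M (n × N) (flatten C(M, 𝕜) π n X) m).PosSemidef) :
    IsPosElem X := by
  set Φ := (matrixValued 𝕜 M (n × N)).comp (flatten C(M, 𝕜) π n)
  have hΦ : ∀ m, (Φ X m).PosSemidef := hX
  obtain ⟨lam, hlam⟩ := LinearMap.exists_leftInverse_of_injective π.toAlgHom.toLinearMap
    (LinearMap.ker_eq_bot.2 hπ)
  replace hlam : ∀ a, lam (π a) = a := fun a => LinearMap.congr_fun hlam a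
  have hinj : ∀ Y Z, Φ Y = Φ Z → Y = Z := fun Y Z h => by
    rw [← unflatten_flatten π hlam Y, ← unflatten_flatten π hlam Z]
    congr 1
    ext p q m
    exact congrArg (fun G : C(M, Matrix (n × N) (n × N) 𝕜) => G m p q) h
  -- Dividing by `c` brings the norm below `1`, as the square root requires; the summand `1` keeps
  -- `c` positive when `Φ X = 0`.
  set c : ℝ := ‖Φ X‖ + 1
  have hc : 0 < c := by positivity
  have hck : (c : 𝕜) ≠ 0 := by exact_mod_cast hc.ne'
  have hcinv : (0 : 𝕜) ≤ ((c⁻¹ : ℝ) : 𝕜) := by exact_mod_cast (inv_pos.2 hc).le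
  have hpsd : ∀ m, (((c⁻¹ : ℝ) : 𝕜) • Φ X m).PosSemidef := fun m => (hΦ m).smul hcinv
  have hnorm : ‖1 - ((c⁻¹ : ℝ) : 𝕜) • Φ X‖ ≤ 1 := by
    refine (ContinuousMap.norm_le _ zero_le_one).2 fun m => (hpsd m).norm_one_sub_le ?_
    rw [norm_smul, RCLike.norm_ofReal, abs_of_pos (inv_pos.2 hc), inv_mul_le_one₀ hc]
    exact (ContinuousMap.norm_coe_le_norm _ m).trans (by simp [c])
  have hsa : star (((c⁻¹ : ℝ) : 𝕜) • Φ X) = ((c⁻¹ : ℝ) : 𝕜) • Φ X := by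
    ext1 m
    exact (hpsd m).isHermitian
  obtain ⟨_, ⟨Y, rfl⟩, hY⟩ := StarSubalgebra.exists_star_mul_self_eq Φ.range
    (isClosed_range_matrixValued_flatten hπ n) (f := ((c⁻¹ : ℝ) : 𝕜) • Φ X)
    (Φ.range.smul_mem ⟨X, rfl⟩ _) hsa hnorm
  have hXY : X = star (((√c : ℝ) : 𝕜) • Y) * (((√c : ℝ) : 𝕜) • Y) := by
    refine hinj _ _ ?_
    change star (Φ Y) * Φ Y = _ at hY
    rw [map_mul, map_star, map_smul, star_smul, smul_mul_smul_comm, hY, RCLike.star_def,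
      RCLike.conj_ofReal, ← RCLike.ofReal_mul, Real.mul_self_sqrt hc.le, RCLike.ofReal_inv,
      smul_inv_smul₀ hck]
  rw [hXY]
  exact isPosElem_star_mul_self _

/-- Tensor products of completely positive maps, one factor being a finite dimensional
`*`-algebra of matrices and the other one `C(M)`, are completely positive. -/
theorem IsCompletelyPositive.tensorProduct_map [CompactSpace M] (hπ : Function.Injective π)
    {S : A →ₗ[𝕜] A} {T : C(M, 𝕜) →ₗ[𝕜] C(M, 𝕜)} (hS : IsCompletelyPositive S)
    (hT : IsCompletelyPositive T) : IsCompletelyPositive (𝕜 := 𝕜) (A := A ⊗[𝕜] C(M, 𝕜)) (B := A ⊗[𝕜] C(M, 𝕜))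
    (TensorProduct.map S T) := by
  have h1 : IsCompletelyPositive (𝕜 := 𝕜) (A := A ⊗[𝕜] C(M, 𝕜)) (B := A ⊗[𝕜] C(M, 𝕜))
      (TensorProduct.map (LinearMap.id : A →ₗ[𝕜] A) T) := by
    intro n X hX
    refine isPosElem_of_posSemidef_flatten hπ fun m => ?_
    have h := (hT.map_isPosElem (hX.map_starAlgHom (flatten C(M, 𝕜) π (Fin n)))).posSemidef_eval m
    -- Matrix coefficients act on the factor `A` only, so they commute with `T`.
    suffices e : flatten C(M, 𝕜) π (Fin n) (X.map (TensorProduct.map LinearMap.id T)) =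
        (flatten C(M, 𝕜) π (Fin n) X).map T by rwa [← e] at h
    refine Matrix.ext fun p q => ?_
    change tensorCoeff C(M, 𝕜) π p.2 q.2 (TensorProduct.map LinearMap.id T (X p.1 q.1)) =
      T (tensorCoeff C(M, 𝕜) π p.2 q.2 (X p.1 q.1))
    generalize X p.1 q.1 = x
    induction x with
    | zero => simp
    | add x y hx hy => simp only [map_add, hx, hy]
    | tmul a b => simp [tensorCoeff_tmul]
  have h2 : IsCompletelyPositive (𝕜 := 𝕜) (A := A ⊗[𝕜] C(M, 𝕜)) (B := A ⊗[𝕜] C(M, 𝕜))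
      (TensorProduct.map S (LinearMap.id : C(M, 𝕜) →ₗ[𝕜] C(M, 𝕜))) := by
    intro n X hX
    refine isPosElem_of_posSemidef_flatten hπ fun m => ?_
    -- At the fixed point `m`, the map `S ⊗ id` has the same value as the composite of evaluation at
    -- `m`, `S` and `a ↦ a ⊗ 1`, each completely positive.
    let ev : C(M, 𝕜) →ₗ[𝕜] 𝕜 := (ContinuousMap.evalAlgHom 𝕜 𝕜 m).toLinearMap
    have hev := isCompletelyPositive_rid_map (A := A) (ω := ev) fun a b => by simp [ev]
    have h := ((isCompletelyPositive_tmul_one (B := C(M, 𝕜))).comp (hS.comp hev)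
      n X hX).posSemidef_flatten (π := π) m
    convert h using 1
    ext p q
    change tensorCoeff C(M, 𝕜) π p.2 q.2 (TensorProduct.map S LinearMap.id (X p.1 q.1)) m =
      tensorCoeff C(M, 𝕜) π p.2 q.2
        (S (TensorProduct.rid 𝕜 A (TensorProduct.map LinearMap.id ev (X p.1 q.1))) ⊗ₜ 1) m
    generalize X p.1 q.1 = x
    induction x with
    | zero => simp
    | add x y hx hy =>
      simp only [map_add, TensorProduct.add_tmul, ContinuousMap.add_apply, hx, hy]
    | tmul a b => simp [tensorCoeff_tmul, ev, mul_comm]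
  have := h2.comp h1
  rwa [← TensorProduct.map_comp, LinearMap.id_comp, LinearMap.comp_id] at this

end Positive

/-- A faithful representation on a finite dimensional Hilbert space, as matrices. -/
theorem exists_matrix_starAlgHom {𝕜 A H : Type*} [RCLike 𝕜] [Ring A] [StarRing A] [Algebra 𝕜 A]
    [NormedAddCommGroup H] [InnerProductSpace 𝕜 H] [CompleteSpace H] [FiniteDimensional 𝕜 H]
    (ρ : A →⋆ₐ[𝕜] (H →L[𝕜] H)) (hρ : Function.Injective ρ) :
    ∃ π : A →⋆ₐ[𝕜] Matrix (Fin (Module.finrank 𝕜 H)) (Fin (Module.finrank 𝕜 H)) 𝕜,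
      Function.Injective π := by
  let e : (H →ₗ[𝕜] H) ≃⋆ₐ[𝕜] (H →L[𝕜] H) :=
    { LinearMap.toContinuousLinearMap with
      map_mul' := fun _ _ => rfl
      map_star' := LinearMap.adjoint_toContinuousLinearMap }
  let e' := e.symm.trans (LinearMap.toMatrixOrthonormal (stdOrthonormalBasis 𝕜 H))
  exact ⟨(StarAlgHomClass.toStarAlgHom e').comp ρ, fun a b h => hρ (e'.injective h)⟩

/-! ### The theorem -/

theorem mainTheorem7 {𝕜 : Type*} [RCLike 𝕜]
    {M : Type*} [TopologicalSpace M] [CompactSpace M] [T2Space M] [Nonempty M]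
    {HM : Type*} [NormedAddCommGroup HM] [InnerProductSpace 𝕜 HM] [CompleteSpace HM]
    {AF : Type*} [Ring AF] [StarRing AF] [Algebra 𝕜 AF] [StarModule 𝕜 AF]
    {HF : Type*} [NormedAddCommGroup HF] [InnerProductSpace 𝕜 HF] [CompleteSpace HF]
    [FiniteDimensional 𝕜 HF] [Nontrivial HF]
    (𝔐 : SpectralTriple 𝕜 C(M, 𝕜) HM) (𝔉 : FiniteSpectralTriple 𝕜 AF HF)
    {IM IF : Type*} (ιM : IM → C(M, 𝕜) →ₗ[𝕜] HM) (hιM : IsRealization ιM)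
    (ιF : IF → AF →ₗ[𝕜] HF) (hιF : IsRealization ιF)
    (UM : ℝ → HM →L[𝕜] HM) (hUM : IsExpNeg 𝔐.D.square.graph UM)
    (U : ℝ → (HF ⊗[𝕜] HM) →L[𝕜] (HF ⊗[𝕜] HM)) (hU : IsExpNeg (productDiracSq 𝔉.D 𝔐.D) U) :
    (IsCompletelyPositiveOn ιM UM ∧ IsCompletelyPositiveOn ιF (finiteHeat 𝔉.D) →
      IsCompletelyPositiveOn (productRealization ιF ιM) U) ∧
    (IsConservativeOn (productRealization ιF ιM) U →
      IsCompletelyPositiveOn (productRealization ιF ιM) U →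
      IsCompletelyPositiveOn ιM UM ∧ IsCompletelyPositiveOn ιF (finiteHeat 𝔉.D)) := by
  -- `A_F` acts unitally on `H_F ≠ 0`; hence some realisation map does not kill its unit.
  have : Nontrivial AF := 𝔉.rep.toAlgHom.toRingHom.domain_nontrivial
  refine ⟨fun ⟨hM, hF⟩ t ht => ?_, fun hcons hpos => ?_⟩
  · obtain ⟨TM, hTM, hTMpos⟩ := hM t ht
    obtain ⟨TF, hTF, hTFpos⟩ := hF t ht
    obtain ⟨π, hπ⟩ := exists_matrix_starAlgHom 𝔉.rep 𝔉.rep_injective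
    refine ⟨TensorProduct.map TF TM, fun p z => ?_, hTFpos.tensorProduct_map hπ hTMpos⟩
    rw [product_heat_eq_mapL hUM hU ht]
    induction z with
    | zero => simp
    | add x y hx hy => simp only [map_add, hx, hy]
    | tmul a b => simp [productRealization, hTF, hTM]
  · obtain ⟨i₀, hi₀⟩ := hιF.exists_one_ne_zero
    obtain ⟨j₀, hj₀⟩ := hιM.exists_one_ne_zero
    -- Inverse eigenvalues on the two units suffice; positivity of `r` is what allows the marginals
    -- to be rescaled without losing complete positivity.
    have key : ∀ t, 0 ≤ t → ∃ r : ℝ, 0 < r ∧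
        (∀ i, finiteHeat 𝔉.D t (ιF i 1) = (r : 𝕜) • ιF i 1) ∧
        (∀ j, UM t (ιM j 1) = (r : 𝕜)⁻¹ • ιM j 1) := fun t ht => by
      obtain ⟨c, hc, hc1, hc2⟩ := exists_eigenvalue_of_fixes_one (E := finiteHeat 𝔉.D t)
        (F := UM t) hi₀ hj₀ fun i j => by
          have := hcons t ht (i, j)
          rwa [product_heat_eq_mapL hUM hU ht] at this
      obtain ⟨r, hr, rfl⟩ := finiteHeat_eigenvalue_pos 𝔉.selfAdjoint hi₀ hc (hc1 i₀)
      exact ⟨r, hr, hc1, hc2⟩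
    constructor
    · intro t ht
      obtain ⟨r, hr, hF, -⟩ := key t ht
      obtain ⟨T, hT, hTpos⟩ := hpos t ht
      rw [product_heat_eq_mapL hUM hU ht] at hT
      obtain ⟨χ, S, hχ, hχ1⟩ := exists_kraus_state 𝔉.rep
      exact exists_isCompletelyPositive_right hιF hιM hT hTpos hi₀ hr hF hχ hχ1
    · intro t ht
      obtain ⟨r, hr, -, hM⟩ := key t ht
      obtain ⟨T, hT, hTpos⟩ := hpos t ht
      rw [product_heat_eq_mapL hUM hU ht] at hT
      obtain ⟨m⟩ := ‹Nonempty M›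
      exact exists_isCompletelyPositive_left hιF hιM hT hTpos hj₀ hr hM
        (χ := (ContinuousMap.evalAlgHom 𝕜 𝕜 m).toLinearMap) (fun a b => by simp) (by simp)
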